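/- Let $\Bbbk$ be a field. For a quiver $Q$, let $\mathbb{P}Q$ be its free (path) category, $e_x$ the path of length $0$ at a vertex $x$, and let $\Bbbk Q$ be the $\Bbbk$-linearization of $\mathbb{P}Q$; paths are composed from right to left. For a set $T$ of morphisms of a $\Bbbk$-category $\mathcal C$, let $\langle T\rangle$ be the ideal of $\mathcal C$ generated by $T$ and $\mathcal C/\langle T\rangle$ the quotient $\Bbbk$-category. Let $\Bbbk\text{-}\mathbf{Cat}$ be the category of $\Bbbk$-categories and $\Bbbk$-functors. Let $Q=(Q_0,Q_1)$ be a quiver, let $R$ be a set of pairs of parallel paths of $Q$, and let $I=\langle Q\mid R\rangle$ be the quotient of $\mathbb{P}Q$ by the congruence generated by $R$; write $\overline{a}$ for the class in $I$ of a path $a$ of $Q$. For each $i\in Q_0$ let $Q^{(i)}$ be a quiver and $R^{(i)}$ a set of morphisms of $\Bbbk Q^{(i)}$, and let $X\colon I\to\Bbbk\text{-}\mathbf{Cat}$ be a functor with $X(i)=\Bbbk Q^{(i)}/\langle R^{(i)}\rangle$ for all $i$. Let $\Phi^{(i)}\colon\Bbbk Q^{(i)}\to X(i)$ be the canonical functor.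 For a path $a\colon i\to j$ of $Q$ and $x\in Q^{(i)}_0$ put $ax:=X(\overline{a})(x)\in Q^{(j)}_0$. The Grothendieck construction $\mathrm{Gr}(X)$ is the $\Bbbk$-category whose objects are the pairs $(i,x)$ with $i\in I$ and $x\in X(i)$, with $$\mathrm{Gr}(X)((i,x),(j,y))=\bigoplus_{a\in I(i,j)}X(j)(X(a)x,y),\qquad (g_b)_b\circ(f_a)_a=\Bigl(\sum_{c=ba}g_b\,X(b)(f_a)\Bigr)_c .$$ Define a quiver $Q'$ as follows. Its vertices are the pairs ${}_ix$ with $i\in Q_0$ and $x\in Q^{(i)}_0$. Its arrows are an arrow ${}_i\alpha\colon{}_ix\to{}_iy$ for each $i\in Q_0$ and each arrow $\alpha\colon x\to y$ of $Q^{(i)}$, and an arrow $(a,{}_ix)\colon{}_ix\to{}_j(ax)$ for each arrow $a\colon i\to j$ of $Q$ and each $x\in Q^{(i)}_0$. Let $\sigma^{(i)}\colon\Bbbk Q^{(i)}\to\Bbbk Q'$ be the $\Bbbk$-functor given by $x\mapsto{}_ix$ and $\alpha\mapsto{}_i\alpha$. For a path $a=a_n\cdots a_1$ of $Q$ starting at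 $i$, and $x\in Q_0^{(i)}$, let $$\pi(a,{}_ix):=(a_n,{}_{i_{n-1}}(a_{n-1}\cdots a_1x))\cdots(a_2,{}_{i_1}(a_1x))(a_1,{}_ix),$$ where $i_m$ is the end of $a_m$, and let $\pi(e_i,{}_ix):=e_{{}_ix}$. For each arrow $a\colon i\to j$ of $Q$ and each arrow $\alpha\colon x\to y$ of $Q^{(i)}$ choose $a\alpha\in\Bbbk Q^{(j)}(ax,ay)$ with $\Phi^{(j)}(a\alpha)=X(\overline{a})(\Phi^{(i)}(\alpha))$. Put $R'=R'_1\cup R'_2\cup R'_3$, where - $R'_1=\{\sigma^{(i)}(\mu)\mid i\in Q_0,\ \mu\in R^{(i)}\}$; - $R'_2=\{\pi(g,{}_ix)-\pi(h,{}_ix)\mid i,j\in Q_0,\ (g,h)\in R(i,j),\ x\in Q^{(i)}_0\}$, where $R(i,j)$ is the set of pairs in $R$ of paths from $i$ to $j$; - $R'_3=\{(a,{}_iy)\,{}_i\alpha-\sigma^{(j)}(a\alpha)\,(a,{}_ix)\mid a\colon i\to j\text{ in }Q_1,\ \alpha\colon x\to y\text{ in }Q^{(i)}_1\}$. Then a choice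 of elements $a\alpha$ exists; for every such choice $\mathrm{Gr}(X)$ is isomorphic in $\Bbbk\text{-}\mathbf{Cat}$ to $\Bbbk Q'/\langle R'\rangle$; and the ideal $\langle R'\rangle$ does not depend on the choice. -/

import Mathlib

open CategoryTheory

universe v₁ u₁ v₂ u₂ v u w

noncomputable section

namespace QuiverPresentation

/-! ### The category of `k`-categories -/

section KCat

/-- A `k`-category: a category enriched in `k`-modules with bilinear composition. -/
structure KCat (k : Type w) [CommRing k] where
  carrier : Type u
  [category : Category.{v} carrier]
  [preadditive : Preadditive carrier]
  [linear : Linear k carrier]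

attribute [instance] KCat.category KCat.preadditive KCat.linear

/-- A `k`-functor between `k`-categories. -/
@[ext]
structure KFunctor {k : Type w} [CommRing k] (C D : KCat.{v, u} k) where
  functor : C.carrier ⥤ D.carrier
  [additive : functor.Additive]
  [linear : functor.Linear k]

attribute [instance] KFunctor.additive KFunctor.linear

/-- The category of `k`-categories and `k`-functors (with strict equality of functors). -/
instance (k : Type w) [CommRing k] : Category (KCat.{v, u} k) where
  Hom C D := KFunctor C D
  id C := { functor := 𝟭 C.carrier }
  comp F G := { functor := F.functor ⋙ G.functor }

/-- The `k`-category given by a category with a linear structure. -/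
abbrev KCat.of (k : Type w) [CommRing k] (C : Type u) [Category.{v} C] [Preadditive C]
    [Linear k C] : KCat.{v, u} k := ⟨C⟩

/-- The `k`-functor underlying a morphism of `k`-categories. -/
abbrev KCat.functorOf {k : Type w} [CommRing k] {C D : KCat.{v, u} k} (F : C ⟶ D) :
    C.carrier ⥤ D.carrier := KFunctor.functor F

instance {k : Type w} [CommRing k] {C D : KCat.{v, u} k} (F : C ⟶ D) :
    (KCat.functorOf F).Additive := KFunctor.additive F

instance {k : Type w} [CommRing k] {C D : KCat.{v, u} k} (F : C ⟶ D) :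
    (KCat.functorOf F).Linear k := KFunctor.linear F

/-- A functor `I ⥤ k-Cat` whose value at each object `i` is the given `k`-category `P i`. -/
structure FunctorWithValues {k : Type w} [CommRing k] {I : Type u₁} [Category.{v₁} I]
    (P : I → KCat.{v, u} k) where
  map : ∀ {i j : I}, (i ⟶ j) → (P i ⟶ P j)
  map_id : ∀ i : I, map (𝟙 i) = 𝟙 (P i)
  map_comp : ∀ {i j l : I} (a : i ⟶ j) (b : j ⟶ l), map (a ≫ b) = map a ≫ map b

/-- The underlying functor. -/
abbrev FunctorWithValues.toFunctor {k : Type w} [CommRing k] {I : Type u₁} [Category.{v₁} I]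
    {P : I → KCat.{v, u} k} (X : FunctorWithValues P) : I ⥤ KCat.{v, u} k where
  obj := P
  map a := X.map a
  map_id := X.map_id
  map_comp := X.map_comp

end KCat

/-! ### The Grothendieck construction of a functor `I ⥤ k-Cat` -/

section Gr

variable {k : Type w} [CommRing k] {I : Type u₁} [Category.{v₁} I]

/-- Objects of the Grothendieck construction: pairs `(i, x)` with `x` an object of `X(i)`. -/
structure Gr (X : I ⥤ KCat.{v, u} k) where
  base : I
  fiber : (X.obj base).carrier

namespace Gr

variable {X : I ⥤ KCat.{v, u} k}

/-- The action `X(a)x` of morphisms of `I` on objects. -/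
abbrev push (X : I ⥤ KCat.{v, u} k) {i j : I} (a : i ⟶ j) (x : (X.obj i).carrier) :
    (X.obj j).carrier := (KCat.functorOf (X.map a)).obj x

lemma push_id (i : I) (x : (X.obj i).carrier) : push X (𝟙 i) x = x := by
  have h := X.map_id i
  simp only [push, h]
  rfl

lemma push_comp {i j l : I} (a : i ⟶ j) (b : j ⟶ l) (x : (X.obj i).carrier) :
    push X (a ≫ b) x = push X b (push X a x) := by
  have h := X.map_comp a b
  simp only [push, h]
  rfl

/-- Morphisms `(i, x) ⟶ (j, y)`: the direct sum of the `X(j)(X(a)x, y)` over `a : i ⟶ j`. -/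
abbrev GrHom (p q : Gr X) : Type (max v₁ v) :=
  DirectSum (p.base ⟶ q.base) (fun a => (push X a p.fiber ⟶ q.fiber))

/-- The product `(f, g) ↦ g ∘ X(b)f : X(ba)x ⟶ z` of `f : X(a)x ⟶ y` and `g : X(b)y ⟶ z`. -/
def mul {p q r : Gr X} (a : p.base ⟶ q.base) (b : q.base ⟶ r.base) :
    (push X a p.fiber ⟶ q.fiber) →ₗ[k] (push X b q.fiber ⟶ r.fiber) →ₗ[k]
      (push X (a ≫ b) p.fiber ⟶ r.fiber) :=
  LinearMap.mk₂ k
    (fun f g => eqToHom (push_comp a b p.fiber) ≫ (KCat.functorOf (X.map b)).map f ≫ g)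
    (by intros; simp) (by intros; simp [Functor.map_smul]) (by intros; simp) (by intros; simp)

open Classical in
/-- The component of degree `a`. -/
def inj {p q : Gr X} (a : p.base ⟶ q.base) :
    (push X a p.fiber ⟶ q.fiber) →ₗ[k] GrHom p q :=
  DirectSum.lof k (p.base ⟶ q.base) (fun a => (push X a p.fiber ⟶ q.fiber)) a

open Classical in
/-- The bilinear composition: the component of degree `c` of the composite of `(f_a)` and `(g_b)`
is the sum of the products of `f_a` and `g_b` over all pairs with `c = ba`. -/
def compHom (p q r : Gr X) : GrHom p q →ₗ[k] GrHom q r →ₗ[k] GrHom p r :=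
  DirectSum.toModule k _ _ (fun a =>
    (DirectSum.toModule k _ _ (fun b => ((mul a b).compr₂ (inj (a ≫ b))).flip)).flip)

lemma compHom_inj {p q r : Gr X} (a : p.base ⟶ q.base) (b : q.base ⟶ r.base)
    (f : push X a p.fiber ⟶ q.fiber) (g : push X b q.fiber ⟶ r.fiber) :
    compHom p q r (inj a f) (inj b g) = inj (a ≫ b) (eqToHom (push_comp a b p.fiber) ≫
      (KCat.functorOf (X.map b)).map f ≫ g) := by
  classical
  simp [compHom, inj, mul]

lemma inj_congr {p q : Gr X} {a b : p.base ⟶ q.base} (h : a = b)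
    (f : push X b p.fiber ⟶ q.fiber) :
    inj b f = inj a (eqToHom (by rw [h]) ≫ f) := by
  subst h; simp

lemma hom_ext {p q : Gr X} {M : Type*} [AddCommMonoid M] [Module k M]
    {F G : GrHom p q →ₗ[k] M} (h : ∀ a f, F (inj a f) = G (inj a f)) : F = G := by
  classical
  apply DirectSum.linearMap_ext
  intro a
  ext f
  exact h a f

lemma map_map_comp {i j l : I} (a : i ⟶ j) (b : j ⟶ l) {x y : (X.obj i).carrier}
    (f : x ⟶ y) : (KCat.functorOf (X.map (a ≫ b))).map f = eqToHom (push_comp a b x) ≫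
      (KCat.functorOf (X.map b)).map ((KCat.functorOf (X.map a)).map f) ≫
        eqToHom (push_comp a b y).symm := by
  have h : KCat.functorOf (X.map (a ≫ b)) =
      KCat.functorOf (X.map a) ⋙ KCat.functorOf (X.map b) := by
    rw [X.map_comp]; rfl
  exact Functor.congr_hom h f

lemma map_map_id (i : I) {x y : (X.obj i).carrier} (f : x ⟶ y) :
    (KCat.functorOf (X.map (𝟙 i))).map f =
      eqToHom (push_id i x) ≫ f ≫ eqToHom (push_id i y).symm := by
  have h : KCat.functorOf (X.map (𝟙 i)) = 𝟭 _ := by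
    rw [X.map_id]; rfl
  exact Functor.congr_hom h f

/-- The identity of `(i, x)`, concentrated in degree `𝟙 i`. -/
def idHom (p : Gr X) : GrHom p p := inj (𝟙 p.base) (eqToHom (push_id p.base p.fiber))

lemma id_compHom (p q : Gr X) (f : GrHom p q) : compHom p p q (idHom p) f = f := by
  suffices h : compHom p p q (idHom p) = LinearMap.id from LinearMap.congr_fun h f
  apply hom_ext
  intro a f
  rw [idHom, compHom_inj, LinearMap.id_apply, inj_congr (Category.id_comp a) f]
  simp [eqToHom_map]

lemma compHom_id (p q : Gr X) (f : GrHom p q) : compHom p q q f (idHom q) = f := by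
  suffices h : (compHom p q q).flip (idHom q) = LinearMap.id from LinearMap.congr_fun h f
  apply hom_ext
  intro a f
  rw [LinearMap.flip_apply, idHom, compHom_inj, LinearMap.id_apply,
    inj_congr (Category.comp_id a) f, map_map_id]
  simp

lemma compHom_assoc (p q r s : Gr X) (f : GrHom p q) (g : GrHom q r) (h : GrHom r s) :
    compHom p r s (compHom p q r f g) h = compHom p q s f (compHom q r s g h) := by
  classical
  induction f using DirectSum.induction_on with
  | zero => simp
  | add f f' hf hf' => simp only [map_add, LinearMap.add_apply, hf, hf']
  | of a f =>
    induction g using DirectSum.induction_on with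
    | zero => simp
    | add g g' hg hg' => simp only [map_add, LinearMap.add_apply, hg, hg']
    | of b g =>
      induction h using DirectSum.induction_on with
      | zero => simp
      | add h h' hh hh' => simp only [map_add, hh, hh']
      | of c h =>
        change compHom p r s (compHom p q r (inj a f) (inj b g)) (inj c h) =
          compHom p q s (inj a f) (compHom q r s (inj b g) (inj c h))
        rw [compHom_inj, compHom_inj, compHom_inj, compHom_inj, inj_congr (Category.assoc a b c),
          map_map_comp]
        simp [eqToHom_map]

/-- The Grothendieck construction as a category. -/
instance : Category (Gr X) where
  Hom p q := GrHom p q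
  id p := idHom p
  comp f g := compHom _ _ _ f g
  id_comp f := id_compHom _ _ f
  comp_id f := compHom_id _ _ f
  assoc f g h := compHom_assoc _ _ _ _ f g h

instance : Preadditive (Gr X) where
  homGroup p q := inferInstanceAs (AddCommGroup (GrHom p q))
  add_comp p q r f f' g := LinearMap.map_add₂ (compHom p q r) f f' g
  comp_add p q r f g g' := LinearMap.map_add (compHom p q r f) g g'

instance : Linear k (Gr X) where
  homModule p q := inferInstanceAs (Module k (GrHom p q))
  smul_comp p q r a f g := LinearMap.map_smul₂ (compHom p q r) a f g
  comp_smul p q r f a g := LinearMap.map_smul (compHom p q r f) a g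

end Gr

end Gr

/-! ### Ideals and quotients of `k`-categories -/

section Ideal

variable (k : Type w) [CommRing k] {C : Type u} [Category.{v} C] [Preadditive C] [Linear k C]

/-- The ideal `⟨S⟩` generated by a class `S` of morphisms of a `k`-category. -/
def ideal (S : MorphismProperty C) (x y : C) : Submodule k (x ⟶ y) :=
  Submodule.span k {f | ∃ (u v : C) (c : x ⟶ u) (s : u ⟶ v) (d : v ⟶ y), S s ∧ f = c ≫ s ≫ d}

variable {k} in
lemma comp_mem_ideal {S : MorphismProperty C} {x y z : C} (f : x ⟶ y) {g : y ⟶ z}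
    (hg : g ∈ ideal k S y z) : f ≫ g ∈ ideal k S x z := by
  suffices h : ideal k S y z ≤ (ideal k S x z).comap (Linear.leftComp k z f) from h hg
  refine Submodule.span_le.2 ?_
  rintro _ ⟨u, v, c, s, d, hs, rfl⟩
  exact Submodule.subset_span ⟨u, v, f ≫ c, s, d, hs, by simp⟩

variable {k} in
lemma mem_ideal_comp {S : MorphismProperty C} {x y z : C} {f : x ⟶ y}
    (hf : f ∈ ideal k S x y) (g : y ⟶ z) : f ≫ g ∈ ideal k S x z := by
  suffices h : ideal k S x y ≤ (ideal k S x z).comap (Linear.rightComp k x g) from h hf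
  refine Submodule.span_le.2 ?_
  rintro _ ⟨u, v, c, s, d, hs, rfl⟩
  exact Submodule.subset_span ⟨u, v, c, s, d ≫ g, hs, by simp⟩

/-- Congruence modulo the ideal `⟨S⟩`. -/
def idealRel (S : MorphismProperty C) : HomRel C := fun x y f g => f - g ∈ ideal k S x y

instance (S : MorphismProperty C) : Congruence (idealRel k S) where
  equivalence :=
    { refl := fun f => by simp [idealRel]
      symm := fun {f g} h => by
        have := Submodule.neg_mem _ h
        rwa [neg_sub] at this
      trans := fun {f g h} h₁ h₂ => by
        have := Submodule.add_mem _ h₁ h₂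
        rwa [sub_add_sub_cancel] at this }
  comp_left f g g' h := by
    have := comp_mem_ideal f h
    rwa [Preadditive.comp_sub] at this
  comp_right g h := by
    have := mem_ideal_comp h g
    rwa [Preadditive.sub_comp] at this

lemma idealRel_add (S : MorphismProperty C) ⦃x y : C⦄ (f₁ f₂ g₁ g₂ : x ⟶ y)
    (hf : idealRel k S f₁ f₂) (hg : idealRel k S g₁ g₂) :
    idealRel k S (f₁ + g₁) (f₂ + g₂) := by
  have := Submodule.add_mem _ hf hg
  rwa [sub_add_sub_comm] at this

lemma idealRel_smul (S : MorphismProperty C) (a : k) ⦃x y : C⦄ (f₁ f₂ : x ⟶ y)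
    (hf : idealRel k S f₁ f₂) : idealRel k S (a • f₁) (a • f₂) := by
  have := Submodule.smul_mem _ a hf
  rwa [smul_sub] at this

/-- The quotient `k`-category `C / ⟨S⟩`. -/
abbrev IdealQuotient (S : MorphismProperty C) := CategoryTheory.Quotient (idealRel k S)

/-- The canonical functor `C ⥤ C / ⟨S⟩`. -/
abbrev proj (S : MorphismProperty C) : C ⥤ IdealQuotient k S :=
  CategoryTheory.Quotient.functor (idealRel k S)

instance (S : MorphismProperty C) : Preadditive (IdealQuotient k S) :=
  CategoryTheory.Quotient.preadditive _ (idealRel_add k S)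

instance (S : MorphismProperty C) : (proj k S).Additive :=
  CategoryTheory.Quotient.functor_additive _ (idealRel_add k S)

instance (S : MorphismProperty C) : Linear k (IdealQuotient k S) :=
  CategoryTheory.Quotient.linear k _ (idealRel_smul k S)

instance (S : MorphismProperty C) : (proj k S).Linear k :=
  CategoryTheory.Quotient.linear_functor k _ (idealRel_smul k S)

end Ideal

/-! ### Path categories -/

section Path

variable (k : Type w) [CommRing k]

/-- The path `k`-category `kQ` of a quiver `Q` with set of vertices `V`: the `k`-linearization of
the free category of `Q`. -/
abbrev PathCat (V : Type u) [Quiver.{v} V] := Free k (Paths V)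

variable {k} in
/-- The linear extension of a functor on morphisms. -/
def linearExtensionHom {C : Type u₁} [Category.{v₁} C] {D : Type u} [Category.{v} D]
    [Preadditive D] [Linear k D] (F : C ⥤ D) (x y : C) :
    (((x ⟶ y) →₀ k)) →ₗ[k] (F.obj x ⟶ F.obj y) :=
  Finsupp.linearCombination k (fun p : x ⟶ y => F.map p)

variable {k} in
lemma linearExtensionHom_single {C : Type u₁} [Category.{v₁} C] {D : Type u} [Category.{v} D]
    [Preadditive D] [Linear k D] (F : C ⥤ D) {x y : C} (p : x ⟶ y) (r : k) :
    linearExtensionHom F x y (Finsupp.single p r) = r • F.map p :=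
  Finsupp.linearCombination_single k r p

variable {k} in
lemma linearExtensionHom_comp {C : Type u₁} [Category.{v₁} C] {D : Type u} [Category.{v} D]
    [Preadditive D] [Linear k D] (F : C ⥤ D) {x y z : C} (f : (x ⟶ y) →₀ k)
    (g : (y ⟶ z) →₀ k) :
    linearExtensionHom F x z
      (f.sum fun p r => g.sum fun q s => Finsupp.single (p ≫ q) (r * s)) =
    linearExtensionHom F x y f ≫ linearExtensionHom F y z g := by
  have h : linearExtensionHom F x z
      (f.sum fun p r => g.sum fun q s => Finsupp.single (p ≫ q) (r * s)) =
      f.sum fun p r => g.sum fun q s => (r * s) • F.map (p ≫ q) := by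
    simp only [Finsupp.sum, map_sum, linearExtensionHom_single]
  rw [h, linearExtensionHom, linearExtensionHom, Finsupp.linearCombination_apply,
    Finsupp.linearCombination_apply]
  simp only [Finsupp.sum, Preadditive.sum_comp, Preadditive.comp_sum, F.map_comp,
    Linear.smul_comp, Linear.comp_smul, Finset.smul_sum, smul_smul]
  rw [Finset.sum_comm]
  simp only [mul_comm]

variable {k} in
/-- The linear extension of a functor to the `k`-linearization of a category. -/
def linearExtension {C : Type u₁} [Category.{v₁} C] {D : Type u} [Category.{v} D] [Preadditive D]
    [Linear k D] (F : C ⥤ D) : Free k C ⥤ D where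
  obj x := F.obj x
  map {x y} f := linearExtensionHom F x y f
  map_id x := (linearExtensionHom_single F (𝟙 (show C from x)) 1).trans
    ((one_smul k _).trans (F.map_id _))
  map_comp f g := linearExtensionHom_comp F f g

variable {V : Type u} [Quiver.{v} V]

/-- A vertex, as an object of the path `k`-category. -/
abbrev vtx (x : V) : PathCat k V := x

/-- A path, as a morphism of the path `k`-category. -/
abbrev ofPath {x y : V} (p : Quiver.Path x y) : vtx k x ⟶ vtx k y :=
  (Free.embedding k (Paths V)).map (X := (Paths.of V).obj x) (Y := (Paths.of V).obj y) p

/-- An arrow, as a morphism of the path `k`-category. -/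
abbrev ofArrow {x y : V} (a : x ⟶ y) : vtx k x ⟶ vtx k y := ofPath k a.toPath

end Path

/-! ### The quiver with relations of a Grothendieck construction -/

section Main

variable {k : Type w} [CommRing k]
  {V : Type u₁} [Quiver.{v₁} V] {R : HomRel (Paths V)}
  {W : V → Type u₂} [∀ i, Quiver.{v₂} (W i)] {S : ∀ i, MorphismProperty (PathCat k (W i))}

/-- The vertex of `Q` underlying an object of `⟨Q ∣ R⟩`. -/
abbrev under (i : CategoryTheory.Quotient R) : V := i.as

/-- The family of `k`-categories `kQ⁽ⁱ⁾/⟨S⁽ⁱ⁾⟩`, indexed by the objects of `⟨Q ∣ R⟩`, that is, by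
the vertices of `Q`. Here `⟨Q ∣ R⟩` is the quotient of the free category of `Q` by the congruence
generated by `R`. -/
abbrev presented (R : HomRel (Paths V)) (S : ∀ i, MorphismProperty (PathCat k (W i)))
    (i : CategoryTheory.Quotient R) : KCat k :=
  KCat.of k (IdealQuotient k (S (under i)))

variable (X : FunctorWithValues (presented R S))

/-- The class in `⟨Q ∣ R⟩` of a path in `Q`. -/
abbrev cls (R : HomRel (Paths V)) {i j : V} (p : Quiver.Path i j) :
    (CategoryTheory.Quotient.functor R).obj ((Paths.of V).obj i) ⟶
      (CategoryTheory.Quotient.functor R).obj ((Paths.of V).obj j) :=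
  (CategoryTheory.Quotient.functor R).map (X := (Paths.of V).obj i) (Y := (Paths.of V).obj j) p

/-- The `k`-functor `X(a̅)` for an arrow `a` of `Q`. -/
abbrev mapArrow {i j : V} (a : i ⟶ j) : IdealQuotient k (S i) ⥤ IdealQuotient k (S j) :=
  KCat.functorOf (X.map (cls R a.toPath))

/-- The vertex `ax = X(a̅)(x)` for an arrow `a` of `Q`. -/
def act {i j : V} (a : i ⟶ j) (x : W i) : W j := ((mapArrow X a).obj ⟨vtx k x⟩).as

/-- The vertex `aₙ ⋯ a₁x` for a path `aₙ ⋯ a₁` of `Q`. -/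
def pathAct {i : V} : {j : V} → Quiver.Path i j → W i → W j
  | _, .nil, x => x
  | _, .cons p a, x => act X a (pathAct p x)

lemma pathAct_eq {i j : V} (p : Quiver.Path i j) (x : W i) :
    pathAct X p x = ((KCat.functorOf (X.map (cls R p))).obj ⟨vtx k x⟩).as := by
  induction p with
  | nil =>
    have h : cls R (.nil : Quiver.Path i i) = 𝟙 _ := rfl
    rw [h, X.map_id]
    rfl
  | @cons j l p a ih =>
    have h : cls R (p.cons a) = cls R p ≫ cls R a.toPath := rfl
    rw [h, X.map_comp, pathAct, ih]
    rfl

lemma pathAct_eq_of_rel {i j : V} {g h : Quiver.Path i j}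
    (r : R (X := (Paths.of V).obj i) (Y := (Paths.of V).obj j) g h) (x : W i) :
    pathAct X g x = pathAct X h x := by
  have e : cls R g = cls R h := CategoryTheory.Quotient.sound R r
  rw [pathAct_eq, pathAct_eq, e]

/-- The vertices `ᵢx` of `Q'`. -/
structure GrVertex (X : FunctorWithValues (presented R S)) where
  idx : V
  pt : W idx

/-- The arrows of `Q'`: a copy `ᵢα : ᵢx ⟶ ᵢy` of each arrow `α : x ⟶ y` of each `Q⁽ⁱ⁾`, and an arrow
`(a, ᵢx) : ᵢx ⟶ ⱼ(ax)` for each arrow `a : i ⟶ j` of `Q` and each vertex `x` of `Q⁽ⁱ⁾`. -/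
inductive GrArrow : GrVertex X → GrVertex X → Type (max u₁ v₁ u₂ v₂)
  | copy {i : V} {x y : W i} (α : x ⟶ y) : GrArrow ⟨i, x⟩ ⟨i, y⟩
  | push {i j : V} (a : i ⟶ j) (x : W i) : GrArrow ⟨i, x⟩ ⟨j, act X a x⟩

/-- The quiver `Q'`. -/
instance : Quiver.{max u₁ v₁ u₂ v₂} (GrVertex X) where
  Hom := GrArrow X

/-- The inclusion of quivers `Q⁽ⁱ⁾ ⟶ Q'`. -/
def copyPrefunctor (i : V) : W i ⥤q GrVertex X where
  obj x := ⟨i, x⟩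
  map α := GrArrow.copy α

/-- The inclusion `σ⁽ⁱ⁾ : kQ⁽ⁱ⁾ ⥤ kQ'`. -/
def copyFunctor (i : V) : PathCat k (W i) ⥤ PathCat k (GrVertex X) :=
  linearExtension (Paths.lift (copyPrefunctor X i ⋙q Paths.of (GrVertex X)) ⋙
    Free.embedding k (Paths (GrVertex X)))

/-- The path `π(p, ᵢx) = (aₙ, aₙ₋₁ ⋯ a₁x) ⋯ (a₂, a₁x)(a₁, x)` of `Q'`, for a path `p = aₙ ⋯ a₁`
of `Q`. -/
def liftPath {i : V} : {j : V} → (p : Quiver.Path i j) → (x : W i) →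
    Quiver.Path (⟨i, x⟩ : GrVertex X) ⟨j, pathAct X p x⟩
  | _, .nil, _ => .nil
  | _, .cons p a, x => .cons (liftPath p x) (GrArrow.push a (pathAct X p x))

/-- The vertex `ᵢx` of `Q'` as an object of `kQ'`. -/
abbrev gv (i : V) (x : W i) : PathCat k (GrVertex X) := vtx k (⟨i, x⟩ : GrVertex X)

/-- The arrow `ᵢα` of `Q'` as a morphism of `kQ'`. -/
abbrev copyArrow {i : V} {x y : W i} (α : x ⟶ y) : gv X i x ⟶ gv X i y :=
  ofArrow k (V := GrVertex X) (x := ⟨i, x⟩) (y := ⟨i, y⟩) (GrArrow.copy α)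

/-- The arrow `(a, ᵢx)` of `Q'` as a morphism of `kQ'`. -/
abbrev pushArrow {i j : V} (a : i ⟶ j) (x : W i) : gv X i x ⟶ gv X j (act X a x) :=
  ofArrow k (V := GrVertex X) (x := ⟨i, x⟩) (y := ⟨j, act X a x⟩) (GrArrow.push a x)

/-- The image `σ⁽ⁱ⁾(f)` in `kQ'` of a morphism `f` of `kQ⁽ⁱ⁾`. -/
abbrev copyMap {i : V} {x y : W i} (f : vtx k x ⟶ vtx k y) : gv X i x ⟶ gv X i y :=
  (copyFunctor X i).map f

/-- The path `π(p, ᵢx)` of `Q'` as a morphism of `kQ'`. -/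
abbrev pathArrow {i j : V} (p : Quiver.Path i j) (x : W i) :
    gv X i x ⟶ gv X j (pathAct X p x) := ofPath k (liftPath X p x)

/-- A choice, for all arrows `a : i ⟶ j` of `Q` and `α : x ⟶ y` of `Q⁽ⁱ⁾`, of a morphism
`aα : ax ⟶ ay` of `kQ⁽ʲ⁾` whose class is the image under `X(a̅)` of the class of `α`. -/
structure ArrowLift where
  lift : ∀ {i j : V} (a : i ⟶ j) {x y : W i} (_ : x ⟶ y),
    vtx k (act X a x) ⟶ vtx k (act X a y)
  proj_lift : ∀ {i j : V} (a : i ⟶ j) {x y : W i} (α : x ⟶ y),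
    (proj k (S j)).map (lift a α) = (mapArrow X a).map ((proj k (S i)).map (ofArrow k α))

variable {X}

/-- The relations `R'`. -/
inductive GrRel (L : ArrowLift X) : MorphismProperty (PathCat k (GrVertex X))
  /-- The copies of the relations of the `Q⁽ⁱ⁾`. -/
  | copied {i : V} {x y : PathCat k (W i)} (μ : x ⟶ y) (hμ : S i μ) :
      GrRel L ((copyFunctor X i).map μ)
  /-- `π(g, ᵢx) - π(h, ᵢx)` for `(g, h)` in `R`. -/
  | lifted {i j : V} (g h : Quiver.Path i j)
      (r : R (X := (Paths.of V).obj i) (Y := (Paths.of V).obj j) g h) (x : W i) :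
      GrRel L (pathArrow X g x -
        pathArrow X h x ≫ eqToHom (congrArg (gv X j) (pathAct_eq_of_rel X r x).symm))
  /-- `(a, ᵢy) ᵢα - ⱼ(aα) (a, ᵢx)`. -/
  | comm {i j : V} (a : i ⟶ j) {x y : W i} (α : x ⟶ y) :
      GrRel L (copyArrow X α ≫ pushArrow X a y - pushArrow X a x ≫ copyMap X (L.lift a α))

end Main

end QuiverPresentation

end

open QuiverPresentation

/-!
Both categories have the pairs `(i, x)` as objects, so the point is to compare morphisms. In
`kQ'/⟨R'⟩` the relations `R'₃` say that the arrows `(a, ᵢx)` form a natural transformation from the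
inclusion of `X(i)` to the composite of `X(a)` with the inclusion of `X(j)` (`qIncl_comp_qPush`).
Hence every path of `Q'` can be sorted: first arrows `(a, ᵢx)`, which make up some `π(p, ᵢx)`, and
then a morphism of a single fiber. By `R'₂` the class of `π(p, ᵢx)` depends only on the class `c` of
`p` in `⟨Q ∣ R⟩`. So the morphisms `(i, x) ⟶ (j, y)` of `kQ'/⟨R'⟩` are spanned by the composites of
`π(c, ᵢx)` with morphisms `X(c)x ⟶ y` of `X(j)`, which is to say that the linear map `ofGr` from the
direct sum over `c` of the `X(j)(X(c)x, y)` is surjective (`ofGr_surjective`).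

In the other direction, `ᵢα ↦ α` (in degree `𝟙 i`) and `(a, ᵢx) ↦ 𝟙 (ax)` (in degree `a`) define a
functor on `kQ'` that vanishes on `R'` (`pathToGr_map_eq_zero`), hence a functor `toGr` from
`kQ'/⟨R'⟩` to `Gr(X)`. It is a left inverse of `ofGr` on morphisms (`toGr_map_ofGr`). Since `ofGr` is
surjective, the two are mutually inverse, and the functoriality of `ofGr` is a consequence of that of
`toGr`.

To see that `π(c, ᵢx)` is well defined without following chains of relations between paths, fix an
object `s` of `kQ'/⟨R'⟩`. The pairs of a vertex `y` of `Q⁽ʲ⁾` and a morphism `s ⟶ ⱼy` form a set that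
depends functorially on `j` in the free category of `Q`, an arrow `a` acting by
`(y, m) ↦ (ay, (a, ⱼy) m)`. The relations `R` act trivially, so that this functor to sets descends
to `⟨Q ∣ R⟩` (`transport`), and `π(c, ᵢx)` is the image under `c` of the pair `(x, 𝟙)`.

A choice of the `aα` exists because `kQ⁽ʲ⁾ ⥤ X(j)` is full. Two choices differ by elements of
`⟨R⁽ʲ⁾⟩`, whose copies lie in the ideal generated by `R'₁`, so that `⟨R'⟩` is the same for both.
-/

noncomputable section

namespace QuiverPresentation

/-! ### Linear extensions of functors -/

section Linearization

variable {k : Type w} [CommRing k] {C : Type u₁} [Category.{v₁} C]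
  {D : Type u} [Category.{v} D] [Preadditive D] [Linear k D]

instance (F : C ⥤ D) : (linearExtension (k := k) F).Additive where
  map_add {x y f g} := map_add (linearExtensionHom (k := k) F x y) f g

instance (F : C ⥤ D) : (linearExtension (k := k) F).Linear k where
  map_smul {x y} f r := map_smul (linearExtensionHom (k := k) F x y) r f

lemma linearExtension_embedding (F : C ⥤ D) {x y : C} (p : x ⟶ y) :
    (linearExtension (k := k) F).map ((Free.embedding k C).map p) = F.map p :=
  (linearExtensionHom_single F p 1).trans (one_smul k _)

lemma free_hom_induction {x y : Free k C} {P : (x ⟶ y) → Prop} (zero : P 0)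
    (add : ∀ f g, P f → P g → P (f + g)) (smul : ∀ (r : k) f, P f → P (r • f))
    (of : ∀ p : (show C from x) ⟶ (show C from y), P ((Free.embedding k C).map p))
    (f : x ⟶ y) : P f := by
  refine Finsupp.induction_linear (motive := P) f zero add fun p r => ?_
  have h : (Finsupp.single p r : x ⟶ y) = r • (Free.embedding k C).map p :=
    (Finsupp.smul_single_one p r).symm
  exact h ▸ smul r _ (of p)

end Linearization

/-! ### Functors and ideals -/

section IdealLift

variable {k : Type w} [CommRing k] {C : Type u₁} [Category.{v₁} C] [Preadditive C] [Linear k C]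
  {D : Type u} [Category.{v} D] [Preadditive D] [Linear k D]

lemma subset_ideal {S : MorphismProperty C} {x y : C} {f : x ⟶ y} (hf : S f) :
    f ∈ ideal k S x y :=
  Submodule.subset_span ⟨x, y, 𝟙 x, f, 𝟙 y, hf, by simp⟩

lemma map_mem_ideal (F : C ⥤ D) [F.Additive] [F.Linear k] {S : MorphismProperty C}
    {T : MorphismProperty D} (h : ∀ {x y : C} (f : x ⟶ y), S f →
      F.map f ∈ ideal k T (F.obj x) (F.obj y))
    {x y : C} {f : x ⟶ y} (hf : f ∈ ideal k S x y) : F.map f ∈ ideal k T (F.obj x) (F.obj y) := by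
  suffices H : ideal k S x y ≤ (ideal k T (F.obj x) (F.obj y)).comap (F.mapLinearMap k) from H hf
  refine Submodule.span_le.2 ?_
  rintro _ ⟨u, v, c, s, d, hs, rfl⟩
  change F.map _ ∈ ideal k T _ _
  rw [F.map_comp, F.map_comp]
  exact comp_mem_ideal _ (mem_ideal_comp (h s hs) _)

lemma ideal_le {S T : MorphismProperty C} (h : ∀ {x y : C} (f : x ⟶ y), S f → f ∈ ideal k T x y)
    (x y : C) : ideal k S x y ≤ ideal k T x y :=
  fun _ hf => map_mem_ideal (𝟭 C) h hf

lemma map_eq_zero_of_mem_ideal (F : C ⥤ D) [F.Additive] [F.Linear k] {S : MorphismProperty C}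
    (h : ∀ {x y : C} (f : x ⟶ y), S f → F.map f = 0)
    {x y : C} {f : x ⟶ y} (hf : f ∈ ideal k S x y) : F.map f = 0 := by
  suffices H : ideal k S x y ≤ LinearMap.ker (F.mapLinearMap k (X := x) (Y := y)) from H hf
  refine Submodule.span_le.2 ?_
  rintro _ ⟨u, v, c, s, d, hs, rfl⟩
  change F.map _ = 0
  rw [F.map_comp, F.map_comp, h s hs, Limits.zero_comp, Limits.comp_zero]

lemma proj_map_eq_iff (S : MorphismProperty C) {x y : C} (f g : x ⟶ y) :
    (proj k S).map f = (proj k S).map g ↔ f - g ∈ ideal k S x y :=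
  CategoryTheory.Quotient.functor_map_eq_iff (idealRel k S) f g

/-- The `k`-functor out of `C / ⟨S⟩` induced by a `k`-functor that vanishes on `S`. -/
def idealLift (F : C ⥤ D) [F.Additive] [F.Linear k] {S : MorphismProperty C}
    (h : ∀ {x y : C} (f : x ⟶ y), S f → F.map f = 0) : IdealQuotient k S ⥤ D :=
  CategoryTheory.Quotient.lift (idealRel k S) F fun x y f g hfg => by
    have := map_eq_zero_of_mem_ideal F h hfg
    rwa [F.map_sub, sub_eq_zero] at this

section

variable (F : C ⥤ D) [F.Additive] [F.Linear k] {S : MorphismProperty C}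
    (h : ∀ {x y : C} (f : x ⟶ y), S f → F.map f = 0)

lemma proj_map_surjective {x y : IdealQuotient k S} (f : x ⟶ y) :
    ∃ g : x.as ⟶ y.as, (proj k S).map g = f :=
  (proj k S).map_surjective (X := x.as) (Y := y.as) f

instance idealLift_additive : (idealLift (k := k) F h).Additive where
  map_add {x y f g} := by
    obtain ⟨f, rfl⟩ := proj_map_surjective f
    obtain ⟨g, rfl⟩ := proj_map_surjective g
    have e := (proj k S).map_add (f := f) (g := g)
    exact (congrArg (idealLift (k := k) F h).map e.symm).trans F.map_add

instance idealLift_linear : (idealLift (k := k) F h).Linear k where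
  map_smul {x y} f r := by
    obtain ⟨f, rfl⟩ := proj_map_surjective f
    have e := Functor.Linear.map_smul (F := proj k S) f r
    exact (congrArg (idealLift (k := k) F h).map e.symm).trans (Functor.Linear.map_smul (F := F) f r)

end

end IdealLift

/-! ### Naturality on generators -/

section Naturality

variable {k : Type w} [CommRing k] {V : Type u₂} [Quiver.{v₂} V]
  {S : MorphismProperty (PathCat k V)}
  {D : Type u} [Category.{v} D] [Preadditive D] [Linear k D]

lemma path_naturality_of_arrows {D : Type*} [Category* D] (F G : Paths V ⥤ D)
    (τ : ∀ x, F.obj x ⟶ G.obj x)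
    (h : ∀ {x y : V} (α : x ⟶ y), F.map ((Paths.of V).map α) ≫ τ ((Paths.of V).obj y) =
      τ ((Paths.of V).obj x) ≫ G.map ((Paths.of V).map α))
    {x y : Paths V} (p : x ⟶ y) : F.map p ≫ τ y = τ x ≫ G.map p := by
  refine Paths.induction_fixed_source (P := fun {y} p => F.map p ≫ τ y = τ x ≫ G.map p) ?_
    (fun p a ih => ?_) p
  · rw [CategoryTheory.Functor.map_id, CategoryTheory.Functor.map_id, Category.id_comp,
      Category.comp_id]
  · rw [F.map_comp, G.map_comp, Category.assoc]
    refine (congrArg (F.map p ≫ ·) (h a)).trans ?_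
    rw [← Category.assoc (τ x), ← ih, Category.assoc]

lemma free_naturality_of_arrows (F G : PathCat k V ⥤ D) [F.Additive] [F.Linear k]
    [G.Additive] [G.Linear k] (τ : ∀ x, F.obj x ⟶ G.obj x)
    (h : ∀ {x y : V} (α : x ⟶ y), F.map (ofArrow k α) ≫ τ (vtx k y) =
      τ (vtx k x) ≫ G.map (ofArrow k α))
    {x y : PathCat k V} (f : x ⟶ y) : F.map f ≫ τ y = τ x ≫ G.map f := by
  refine free_hom_induction (P := fun f => F.map f ≫ τ y = τ x ≫ G.map f) ?_ ?_ ?_ ?_ f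
  · simp only [Functor.map_zero, Limits.zero_comp, Limits.comp_zero]
  · intro f g hf hg
    simp only [Functor.map_add, Preadditive.add_comp, Preadditive.comp_add, hf, hg]
  · intro r f hf
    simp only [Functor.map_smul, Linear.smul_comp, Linear.comp_smul, hf]
  · intro p
    let E := Free.embedding k (Paths V)
    exact path_naturality_of_arrows (E ⋙ F) (E ⋙ G) (fun x => τ (E.obj x)) h p

/-- A family of morphisms between two `k`-functors on a presented `k`-category is natural as soon
as it is compatible with the arrows of the quiver. -/
lemma naturality_of_arrows (F G : IdealQuotient k S ⥤ D) [F.Additive] [F.Linear k]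
    [G.Additive] [G.Linear k] (τ : ∀ x, F.obj x ⟶ G.obj x)
    (h : ∀ {x y : V} (α : x ⟶ y), F.map ((proj k S).map (ofArrow k α)) ≫ τ ⟨vtx k y⟩ =
      τ ⟨vtx k x⟩ ≫ G.map ((proj k S).map (ofArrow k α)))
    {x y : IdealQuotient k S} (f : x ⟶ y) : F.map f ≫ τ y = τ x ≫ G.map f := by
  obtain ⟨f, rfl⟩ := proj_map_surjective f
  exact free_naturality_of_arrows (proj k S ⋙ F) (proj k S ⋙ G)
    (fun x => τ ((proj k S).obj x)) h f

end Naturality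

/-! ### Morphisms of the Grothendieck construction -/

namespace Gr

variable {k : Type w} [CommRing k] {I : Type u₁} [Category.{v₁} I] {X : I ⥤ KCat.{v, u} k}

/-- `inj a`, with values in the morphisms of the category `Gr X`. -/
def ofDeg {i j : I} (a : i ⟶ j) {x : (X.obj i).carrier} {y : (X.obj j).carrier} :
    (push X a x ⟶ y) →ₗ[k] ((⟨i, x⟩ : Gr X) ⟶ ⟨j, y⟩) :=
  inj (p := ⟨i, x⟩) (q := ⟨j, y⟩) a

lemma ofDeg_comp_ofDeg {i j l : I} (a : i ⟶ j) (b : j ⟶ l) {x : (X.obj i).carrier}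
    {y : (X.obj j).carrier} {z : (X.obj l).carrier} (f : push X a x ⟶ y) (g : push X b y ⟶ z) :
    ofDeg a f ≫ ofDeg b g =
      ofDeg (a ≫ b) (eqToHom (push_comp a b x) ≫ (KCat.functorOf (X.map b)).map f ≫ g) :=
  compHom_inj (p := ⟨i, x⟩) (q := ⟨j, y⟩) (r := ⟨l, z⟩) a b f g

lemma ofDeg_congr {i j : I} {a b : i ⟶ j} (h : a = b) {x : (X.obj i).carrier}
    {y : (X.obj j).carrier} (f : push X b x ⟶ y) :
    (ofDeg b f : (⟨i, x⟩ : Gr X) ⟶ ⟨j, y⟩) = ofDeg a (eqToHom (by rw [h]) ≫ f) :=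
  inj_congr (p := ⟨i, x⟩) (q := ⟨j, y⟩) h f

lemma hom_induction {i j : I} {x : (X.obj i).carrier} {y : (X.obj j).carrier}
    {P : ((⟨i, x⟩ : Gr X) ⟶ ⟨j, y⟩) → Prop} (zero : P 0)
    (add : ∀ f g, P f → P g → P (f + g)) (of : ∀ a f, P (ofDeg a f))
    (f : (⟨i, x⟩ : Gr X) ⟶ ⟨j, y⟩) : P f := by
  classical
  exact DirectSum.induction_on (motive := P) f zero of add

/-- The inclusion of the fiber `X(i)` into the Grothendieck construction. -/
def incl (X : I ⥤ KCat.{v, u} k) (i : I) : (X.obj i).carrier ⥤ Gr X where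
  obj x := ⟨i, x⟩
  map {x y} f := ofDeg (𝟙 i) (eqToHom (push_id i x) ≫ f)
  map_id x := by rw [Category.comp_id]; rfl
  map_comp {x y z} f g := by
    rw [ofDeg_comp_ofDeg, ofDeg_congr (Category.comp_id (𝟙 i)), map_map_id]
    simp

instance incl_additive (i : I) : (incl X i).Additive where
  map_add {x y f g} := by
    exact (congrArg (ofDeg (𝟙 i)) (Preadditive.comp_add ..)).trans (map_add _ _ _)

instance incl_linear (i : I) : (incl X i).Linear k where
  map_smul f r := by
    exact (congrArg (ofDeg (𝟙 i)) (Linear.comp_smul ..)).trans (map_smul _ _ _)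

/-- The morphism `(i, x) ⟶ (j, X(a)x)` of degree `a` whose component is the identity. -/
def pushHom {i j : I} (a : i ⟶ j) (x : (X.obj i).carrier) :
    (incl X i).obj x ⟶ (incl X j).obj (push X a x) :=
  ofDeg a (𝟙 (push X a x))

lemma ofDeg_comp_incl {i j : I} (a : i ⟶ j) {x : (X.obj i).carrier} {y z : (X.obj j).carrier}
    (f : push X a x ⟶ y) (g : y ⟶ z) :
    ofDeg a f ≫ (incl X j).map g = ofDeg a (f ≫ g) := by
  refine (ofDeg_comp_ofDeg a (𝟙 j) f (eqToHom (push_id j y) ≫ g)).trans ?_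
  rw [ofDeg_congr (Category.comp_id a) (f ≫ g), map_map_id]
  simp

lemma incl_comp_pushHom {i j : I} (a : i ⟶ j) {x y : (X.obj i).carrier} (f : x ⟶ y) :
    (incl X i).map f ≫ pushHom a y =
      pushHom a x ≫ (incl X j).map ((KCat.functorOf (X.map a)).map f) := by
  refine (ofDeg_comp_ofDeg (𝟙 i) a (eqToHom (push_id i x) ≫ f) (𝟙 _)).trans
    (Eq.trans ?_ (ofDeg_comp_incl a (𝟙 _) _).symm)
  rw [ofDeg_congr (Category.id_comp a).symm]
  simp [eqToHom_map]

/-- Up to the identification `X(ba)x = X(b)X(a)x`, the morphisms `pushHom` compose. -/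
lemma ofDeg_eqToHom_comp_pushHom {i j l : I} (a : i ⟶ j) (b : j ⟶ l) {x : (X.obj i).carrier}
    {y : (X.obj j).carrier} (h : push X a x = y) :
    ofDeg a (eqToHom h) ≫ pushHom b y =
      ofDeg (a ≫ b) (eqToHom ((push_comp a b x).trans (congrArg _ h))) := by
  refine (ofDeg_comp_ofDeg a b (eqToHom h) (𝟙 _)).trans ?_
  rw [eqToHom_map, eqToHom_trans_assoc, Category.comp_id]

end Gr

/-! ### Arrows and paths in `kQ'` -/

section Main

variable {k : Type w} [CommRing k]
  {V : Type u₁} [Quiver.{v₁} V] {R : HomRel (Paths V)}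
  {W : V → Type u₂} [∀ i, Quiver.{v₂} (W i)] {S : ∀ i, MorphismProperty (PathCat k (W i))}
  {X : FunctorWithValues (presented R S)}

instance (i : V) : (copyFunctor X i).Additive :=
  inferInstanceAs (linearExtension _).Additive

instance (i : V) : (copyFunctor X i).Linear k :=
  inferInstanceAs ((linearExtension _).Linear k)

lemma copyMap_ofArrow {i : V} {x y : W i} (α : x ⟶ y) :
    copyMap X (ofArrow k α) = copyArrow X α := by
  refine (linearExtension_embedding _ _).trans ?_
  exact congrArg (Free.embedding k (Paths (GrVertex X))).map (Category.id_comp _)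

lemma pathArrow_cons {i j l : V} (p : Quiver.Path i j) (a : j ⟶ l) (x : W i) :
    pathArrow X (p.cons a) x = pathArrow X p x ≫ pushArrow X a (pathAct X p x) :=
  (Free.embedding k (Paths (GrVertex X))).map_comp
    (X := (Paths.of (GrVertex X)).obj ⟨i, x⟩) (Y := (Paths.of (GrVertex X)).obj ⟨j, pathAct X p x⟩)
    (Z := (Paths.of (GrVertex X)).obj ⟨l, pathAct X (p.cons a) x⟩) (liftPath X p x)
    (Quiver.Hom.toPath (V := GrVertex X) (GrArrow.push a (pathAct X p x)))

lemma cls_surjective {i j : V} (c : (⟨i⟩ : CategoryTheory.Quotient R) ⟶ ⟨j⟩) :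
    ∃ p : Quiver.Path i j, cls R p = c :=
  (CategoryTheory.Quotient.functor R).map_surjective
    (X := (Paths.of V).obj i) (Y := (Paths.of V).obj j) c

/-! ### Choices of the `aα` -/

theorem nonempty_arrowLift (X : FunctorWithValues (presented R S)) : Nonempty (ArrowLift X) := by
  have h {i j : V} (a : i ⟶ j) {x y : W i} (α : x ⟶ y) :=
    proj_map_surjective ((mapArrow X a).map ((proj k (S i)).map (ofArrow k α)))
  exact ⟨⟨fun a _ _ α => (h a α).choose, fun a _ _ α => (h a α).choose_spec⟩⟩

lemma copyMap_mem_ideal (L : ArrowLift X) {i : V} {x y : W i} {f : vtx k x ⟶ vtx k y}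
    (hf : f ∈ ideal k (S i) (vtx k x) (vtx k y)) :
    copyMap X f ∈ ideal k (GrRel L) (gv X i x) (gv X i y) :=
  map_mem_ideal (copyFunctor X i) (fun _ hs => subset_ideal (GrRel.copied _ hs)) hf

/-- Two choices of `aα` differ by a morphism of `⟨R⁽ʲ⁾⟩`, whose copy lies in `⟨R'⟩`. -/
lemma ideal_grRel_le (L L' : ArrowLift X) (x y : PathCat k (GrVertex X)) :
    ideal k (GrRel L) x y ≤ ideal k (GrRel L') x y := by
  refine ideal_le (fun f hf => ?_) x y
  cases hf with
  | copied μ hμ => exact subset_ideal (GrRel.copied μ hμ)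
  | lifted g h r x => exact subset_ideal (GrRel.lifted g h r x)
  | @comm i j a x y α =>
    have h : L'.lift a α - L.lift a α ∈ ideal k (S j) _ _ :=
      (proj_map_eq_iff _ _ _).1 ((L'.proj_lift a α).trans (L.proj_lift a α).symm)
    have h₁ := comp_mem_ideal (pushArrow X a x) (copyMap_mem_ideal L' h)
    have h₂ := Submodule.add_mem _ (subset_ideal (k := k) (GrRel.comm (L := L') a α)) h₁
    have e : copyMap X (L'.lift a α - L.lift a α) =
      copyMap X (L'.lift a α) - copyMap X (L.lift a α) := (copyFunctor X j).map_sub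
    rw [e, Preadditive.comp_sub, sub_add_sub_cancel] at h₂
    exact h₂

/-! ### Arrows and fibers in `kQ'/⟨R'⟩` -/

variable (L : ArrowLift X)

/-- The vertex `ᵢx` as an object of `kQ'/⟨R'⟩`. -/
abbrev qObj (i : V) (x : W i) : IdealQuotient k (GrRel L) := ⟨gv X i x⟩

lemma proj_copyFunctor_map_eq_zero (i : V) {x y : PathCat k (W i)} (f : x ⟶ y) (hf : S i f) :
    (copyFunctor X i ⋙ proj k (GrRel L)).map f = 0 := by
  have h := (proj_map_eq_iff (k := k) (GrRel L) ((copyFunctor X i).map f) 0).2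
    (by rw [sub_zero]; exact subset_ideal (GrRel.copied f hf))
  exact h.trans (Functor.map_zero _ _ _)

/-- The functor `X(i) ⥤ kQ'/⟨R'⟩` induced by `σ⁽ⁱ⁾`. -/
def qIncl (i : V) : IdealQuotient k (S i) ⥤ IdealQuotient k (GrRel L) :=
  idealLift (copyFunctor X i ⋙ proj k (GrRel L)) (proj_copyFunctor_map_eq_zero L i)

instance (i : V) : (qIncl L i).Additive :=
  idealLift_additive _ (proj_copyFunctor_map_eq_zero L i)

instance (i : V) : (qIncl L i).Linear k :=
  idealLift_linear _ (proj_copyFunctor_map_eq_zero L i)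

/-- The class of the arrow `(a, ᵢx)` in `kQ'/⟨R'⟩`. -/
def qPush {i j : V} (a : i ⟶ j) (x : W i) : qObj L i x ⟶ qObj L j (act X a x) :=
  (proj k (GrRel L)).map (pushArrow X a x)

instance {i j : V} (a : i ⟶ j) : (mapArrow X a).Additive :=
  KFunctor.additive (X.map (cls R a.toPath))

instance {i j : V} (a : i ⟶ j) : (mapArrow X a).Linear k :=
  KFunctor.linear (X.map (cls R a.toPath))

/-- The arrows `(a, ᵢx)` form a natural transformation `X(i) ⟶ X(j) ∘ X(a)` of functors to
`kQ'/⟨R'⟩`: by the relations `R'₃` for arrows, and hence for all morphisms. -/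
lemma qIncl_comp_qPush {i j : V} (a : i ⟶ j) {x y : IdealQuotient k (S i)} (f : x ⟶ y) :
    (qIncl L i).map f ≫ qPush L a y.as =
      qPush L a x.as ≫ (qIncl L j).map ((mapArrow X a).map f) := by
  refine naturality_of_arrows (qIncl L i) (mapArrow X a ⋙ qIncl L j)
    (fun x => qPush L a x.as) (fun {x y} α => ?_) f
  have e₁ : (qIncl L i).map ((proj k (S i)).map (ofArrow k α)) =
      (proj k (GrRel L)).map (copyArrow X α) :=
    congrArg (proj k (GrRel L)).map (copyMap_ofArrow α)
  have e₂ : (mapArrow X a ⋙ qIncl L j).map ((proj k (S i)).map (ofArrow k α)) =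
      (proj k (GrRel L)).map (copyMap X (L.lift a α)) :=
    congrArg (qIncl L j).map (L.proj_lift a α).symm
  have h := (proj_map_eq_iff (k := k) (GrRel L) _ _).2 (subset_ideal (GrRel.comm (L := L) a α))
  rw [Functor.map_comp, Functor.map_comp] at h
  exact ((congrArg (· ≫ qPush L a y) e₁).trans h).trans (congrArg (qPush L a x ≫ ·) e₂.symm)

/-! ### Independence of `π(p, ᵢx)` from the representative `p` -/

/-- For an object `s` of `kQ'/⟨R'⟩`, the pairs of a vertex `y` of `Q⁽ʲ⁾` and a morphism `s ⟶ ⱼy`. An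
arrow `a` of `Q` acts by composition with `(a, ⱼy)`. Keeping the vertex `y` in the data
avoids transports along equations of vertices: paths that are related by `R` have the same effect on
`y` only propositionally. -/
def transportPrefunctor (s : IdealQuotient k (GrRel L)) : V ⥤q Type _ where
  obj j := Σ y : W j, (s ⟶ qObj L j y)
  map a := ↾ fun m => ⟨act X a m.1, m.2 ≫ qPush L a m.1⟩

lemma transport_path (s : IdealQuotient k (GrRel L)) {i j : V} (p : Quiver.Path i j)
    (m : Σ y : W i, (s ⟶ qObj L i y)) :
    (ConcreteCategory.hom ((Paths.lift (transportPrefunctor L s)).map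
      (X := (Paths.of V).obj i) (Y := (Paths.of V).obj j) p) m : Σ y : W j, (s ⟶ qObj L j y)) =
      ⟨pathAct X p m.1, m.2 ≫ (proj k (GrRel L)).map (pathArrow X p m.1)⟩ := by
  induction p with
  | nil =>
    refine Sigma.ext rfl (heq_of_eq ?_)
    exact ((congrArg (m.2 ≫ ·) ((proj k (GrRel L)).map_id _)).trans (Category.comp_id _)).symm
  | @cons j l p a ih =>
    refine (congrArg (fun n : Σ y : W j, (s ⟶ qObj L j y) =>
      (⟨act X a n.1, n.2 ≫ qPush L a n.1⟩ : Σ y : W l, (s ⟶ qObj L l y))) ih).trans ?_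
    refine Sigma.ext rfl (heq_of_eq ?_)
    rw [pathArrow_cons]
    exact (Category.assoc _ _ _).trans
      (congrArg (m.2 ≫ ·) ((proj k (GrRel L)).map_comp _ _).symm)

lemma sigma_ext_of_eqToHom {s : IdealQuotient k (GrRel L)} {j : V} {y z : W j} (h : y = z)
    {m : s ⟶ qObj L j y} {n : s ⟶ qObj L j z}
    (e : m = n ≫ (proj k (GrRel L)).map (eqToHom (congrArg (gv X j) h.symm))) :
    (⟨y, m⟩ : Σ y : W j, (s ⟶ qObj L j y)) = ⟨z, n⟩ := by
  subst h
  refine Sigma.ext rfl (heq_of_eq (e.trans ?_))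
  exact (congrArg (n ≫ ·) ((proj k (GrRel L)).map_id _)).trans (Category.comp_id _)

lemma proj_lifted {i j : V} {g h : Quiver.Path i j}
    (r : R (X := (Paths.of V).obj i) (Y := (Paths.of V).obj j) g h) (x : W i) :
    (proj k (GrRel L)).map (pathArrow X g x) = (proj k (GrRel L)).map (pathArrow X h x) ≫
      (proj k (GrRel L)).map (eqToHom (congrArg (gv X j) (pathAct_eq_of_rel X r x).symm)) :=
  ((proj_map_eq_iff (k := k) (GrRel L) _ _).2 (subset_ideal (GrRel.lifted (L := L) g h r x))).trans
    ((proj k (GrRel L)).map_comp _ _)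

/-- The action of `⟨Q ∣ R⟩` on pairs of a vertex `y` of `Q⁽ʲ⁾` and a morphism `s ⟶ ⱼy`. The relations
`π(g, ᵢx) - π(h, ᵢx)` make the action of the paths of `Q` descend. -/
def transport (s : IdealQuotient k (GrRel L)) : CategoryTheory.Quotient R ⥤ Type _ :=
  CategoryTheory.Quotient.lift R (Paths.lift (transportPrefunctor L s)) fun i j g h r => by
    ext m
    refine (transport_path L s g m).trans (Eq.trans ?_ (transport_path L s h m).symm)
    refine sigma_ext_of_eqToHom L (pathAct_eq_of_rel X r m.1) ?_
    exact (congrArg (m.2 ≫ ·) (proj_lifted L r m.1)).trans (Category.assoc _ _ _).symm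

/-- The vertex `cx` together with the morphism `π(c, ᵢx) : ᵢx ⟶ ⱼ(cx)` of `kQ'/⟨R'⟩`, for a morphism
`c` of `⟨Q ∣ R⟩`. -/
def qPath {i j : V} (c : (⟨i⟩ : CategoryTheory.Quotient R) ⟶ ⟨j⟩) (x : W i) :
    Σ y : W j, (qObj L i x ⟶ qObj L j y) :=
  ConcreteCategory.hom ((transport L (qObj L i x)).map c)
    (⟨x, 𝟙 _⟩ : Σ y : W i, (qObj L i x ⟶ qObj L i y))

lemma qPath_cls {i j : V} (p : Quiver.Path i j) (x : W i) :
    qPath L (cls R p) x = ⟨pathAct X p x, (proj k (GrRel L)).map (pathArrow X p x)⟩ :=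
  (transport_path L (qObj L i x) p ⟨x, 𝟙 _⟩).trans
    (Sigma.ext rfl (heq_of_eq (Category.id_comp _)))

lemma qPath_comp_arrow {i j l : V} (c : (⟨i⟩ : CategoryTheory.Quotient R) ⟶ ⟨j⟩) (a : j ⟶ l)
    (x : W i) : qPath L (c ≫ cls R a.toPath) x =
      ⟨act X a (qPath L c x).1, (qPath L c x).2 ≫ qPush L a (qPath L c x).1⟩ := by
  obtain ⟨p, rfl⟩ := cls_surjective c
  rfl

lemma push_eq_qPath_fst {i j : V} (c : (⟨i⟩ : CategoryTheory.Quotient R) ⟶ ⟨j⟩) (x : W i) :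
    (⟨vtx k (qPath L c x).1⟩ : IdealQuotient k (S j)) = Gr.push X.toFunctor c ⟨vtx k x⟩ := by
  obtain ⟨p, rfl⟩ := cls_surjective c
  refine (congrArg (fun m : Σ y : W j, (qObj L i x ⟶ qObj L j y) =>
    (⟨vtx k m.1⟩ : IdealQuotient k (S j))) (qPath_cls L p x)).trans ?_
  exact congrArg (fun y : W j => (⟨vtx k y⟩ : IdealQuotient k (S j))) (pathAct_eq X p x)

/-! ### The linear maps from `Gr(X)` to `kQ'/⟨R'⟩` -/

/-- The object `(i, x)` of the Grothendieck construction. -/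
abbrev grObj (X : FunctorWithValues (presented R S)) (i : V) (x : W i) : Gr X.toFunctor :=
  ⟨⟨i⟩, ⟨vtx k x⟩⟩

open Classical in
/-- The linear map that sends `f : X(c)x ⟶ y`, in degree `c`, to the composite of `π(c, ᵢx)` and the
copy of `f`. The `eqToHom` identifies `X(c)x` with the vertex recorded by `qPath`. -/
def ofGr (i : V) (x : W i) (j : V) (y : W j) :
    (grObj X i x ⟶ grObj X j y) →ₗ[k] (qObj L i x ⟶ qObj L j y) :=
  DirectSum.toModule k _ _ fun c =>
    (Linear.leftComp k (qObj L j y) (qPath L c x).2).comp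
      (((qIncl L j).mapLinearMap k).comp
        (Linear.leftComp k _ (eqToHom (push_eq_qPath_fst L c x))))

lemma ofGr_ofDeg {i j : V} (c : (⟨i⟩ : CategoryTheory.Quotient R) ⟶ ⟨j⟩) (x : W i) (y : W j)
    (f : Gr.push X.toFunctor c ⟨vtx k x⟩ ⟶ ⟨vtx k y⟩) :
    ofGr L i x j y (Gr.ofDeg (X := X.toFunctor) c f) = (qPath L c x).2 ≫
      (qIncl L j).map (eqToHom (push_eq_qPath_fst L c x) ≫ f) := by
  classical
  exact DirectSum.toModule_lof k
    (M := fun c => (Gr.push X.toFunctor c ⟨vtx k x⟩ ⟶ (⟨vtx k y⟩ : IdealQuotient k (S j)))) c f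

/-- The equation `hm` allows any description of `π(c, ᵢx)`, also one whose vertex `m.1` is only
propositionally equal to `X(c)x`. -/
lemma mem_range_ofGr {i j : V} (c : (⟨i⟩ : CategoryTheory.Quotient R) ⟶ ⟨j⟩) (x : W i) (y : W j)
    {m : Σ z : W j, (qObj L i x ⟶ qObj L j z)} (hm : qPath L c x = m)
    (h : (⟨vtx k m.1⟩ : IdealQuotient k (S j)) ⟶ ⟨vtx k y⟩) {f : qObj L i x ⟶ qObj L j y}
    (hf : f = m.2 ≫ (qIncl L j).map h) : f ∈ LinearMap.range (ofGr L i x j y) := by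
  subst hm
  subst hf
  refine ⟨Gr.ofDeg (X := X.toFunctor) c (eqToHom (push_eq_qPath_fst L c x).symm ≫ h), ?_⟩
  rw [ofGr_ofDeg, eqToHom_trans_assoc, eqToHom_refl, Category.id_comp]

/-- The image of `ofGr` is closed under composition with the arrows of `Q'`. For an arrow `(a, ⱼy)`
this is where the arrows of `Q` are moved past those of the fibers. -/
lemma mem_range_ofGr_comp {i j l : V} {x : W i} {y : W j} {z : W l}
    (α : GrArrow X ⟨j, y⟩ ⟨l, z⟩) {f : qObj L i x ⟶ qObj L j y}
    (hf : f ∈ LinearMap.range (ofGr L i x j y)) :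
    f ≫ (proj k (GrRel L)).map
      (ofArrow k (V := GrVertex X) (x := ⟨j, y⟩) (y := ⟨l, z⟩) α) ∈
        LinearMap.range (ofGr L i x l z) := by
  obtain ⟨f, rfl⟩ := hf
  refine Gr.hom_induction (X := X.toFunctor) (P := fun f => ofGr L i x j y f ≫
    (proj k (GrRel L)).map (ofArrow k (V := GrVertex X) (x := ⟨j, y⟩) (y := ⟨l, z⟩) α) ∈
      LinearMap.range (ofGr L i x l z)) ?_ (fun f g hf hg => ?_) (fun c f => ?_) f
  · rw [map_zero, Limits.zero_comp]
    exact Submodule.zero_mem _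
  · rw [map_add, Preadditive.add_comp]
    exact Submodule.add_mem _ hf hg
  · cases α with
    | @copy j y z α =>
      have e : (proj k (GrRel L)).map (copyArrow X α) =
          (qIncl L j).map ((proj k (S j)).map (ofArrow k α)) :=
        congrArg (proj k (GrRel L)).map (copyMap_ofArrow α).symm
      refine mem_range_ofGr L c x z rfl
        ((eqToHom (push_eq_qPath_fst L c x) ≫ f) ≫ (proj k (S j)).map (ofArrow k α)) ?_
      refine (congrArg₂ (· ≫ ·) (ofGr_ofDeg L c x y f) e).trans ((Category.assoc _ _ _).trans ?_)
      exact congrArg ((qPath L c x).2 ≫ ·) ((qIncl L j).map_comp _ _).symm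
    | push a y =>
      refine mem_range_ofGr L (c ≫ cls R a.toPath) x (act X a y) (qPath_comp_arrow L c a x)
        ((mapArrow X a).map (eqToHom (push_eq_qPath_fst L c x) ≫ f)) ?_
      refine (congrArg (· ≫ qPush L a y) (ofGr_ofDeg L c x y f)).trans
        ((Category.assoc _ _ _).trans (Eq.trans ?_ (Category.assoc _ _ _).symm))
      exact congrArg ((qPath L c x).2 ≫ ·)
        (qIncl_comp_qPush L a (eqToHom (push_eq_qPath_fst L c x) ≫ f))

/-- By induction on the length, every path of `Q'` has its class in the image of `ofGr`. -/
lemma ofGr_surjective (i : V) (x : W i) (j : V) (y : W j) :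
    Function.Surjective (ofGr L i x j y) := by
  rw [← LinearMap.range_eq_top, eq_top_iff]
  intro f _
  obtain ⟨f, rfl⟩ := proj_map_surjective f
  refine free_hom_induction (P := fun f => (proj k (GrRel L)).map f ∈
    LinearMap.range (ofGr L i x j y)) ?_ (fun f g hf hg => ?_) (fun r f hf => ?_) (fun p => ?_) f
  · rw [Functor.map_zero]
    exact Submodule.zero_mem _
  · rw [Functor.map_add]
    exact Submodule.add_mem _ hf hg
  · rw [Functor.Linear.map_smul (F := proj k (GrRel L)) f r]
    exact Submodule.smul_mem _ r hf
  · refine Quiver.Path.rec (motive := fun v (p : Quiver.Path (⟨i, x⟩ : GrVertex X) v) =>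
      (proj k (GrRel L)).map (ofPath k p) ∈ LinearMap.range (ofGr L i x v.idx v.pt)) ?_
      (fun {v w} p α ih => ?_) p
    · refine mem_range_ofGr L (cls R .nil) x x (qPath_cls L .nil x) (𝟙 _) ?_
      exact ((congrArg (_ ≫ ·) ((qIncl L i).map_id _)).trans (Category.comp_id _)).symm
    · have e : (proj k (GrRel L)).map (ofPath k (p.cons α)) =
          (proj k (GrRel L)).map (ofPath k p) ≫ (proj k (GrRel L)).map (ofArrow k α) := by
        rw [← Functor.map_comp]
        exact congrArg (proj k (GrRel L)).map ((Free.embedding k (Paths (GrVertex X))).map_comp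
          (X := (Paths.of (GrVertex X)).obj ⟨i, x⟩) (Y := (Paths.of (GrVertex X)).obj v)
          (Z := (Paths.of (GrVertex X)).obj w) p (Quiver.Hom.toPath α))
      rw [e]
      exact mem_range_ofGr_comp L α ih

/-! ### The functor from `kQ'/⟨R'⟩` to the Grothendieck construction -/

/-- The assignment of `ᵢα ↦ α` and `(a, ᵢx) ↦ 𝟙 (ax)` in degrees `𝟙 i` and `a`. -/
def toGrPrefunctor (X : FunctorWithValues (presented R S)) : GrVertex X ⥤q Gr X.toFunctor where
  obj v := grObj X v.idx v.pt
  map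
    | .copy (i := i) α => (Gr.incl X.toFunctor ⟨i⟩).map ((proj k (S i)).map (ofArrow k α))
    | .push a x => Gr.pushHom (X := X.toFunctor) (cls R a.toPath) ⟨vtx k x⟩

/-- The linear extension of `toGrPrefunctor` to `kQ'`. -/
def pathToGr (X : FunctorWithValues (presented R S)) :
    PathCat k (GrVertex X) ⥤ Gr X.toFunctor :=
  linearExtension (Paths.lift (toGrPrefunctor X))

instance : (pathToGr X).Additive :=
  inferInstanceAs (linearExtension _).Additive

instance : (pathToGr X).Linear k :=
  inferInstanceAs ((linearExtension _).Linear k)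

/-- The inclusion `X(i) ⥤ Gr(X)` for a vertex `i` of `Q`. -/
abbrev grIncl (X : FunctorWithValues (presented R S)) (i : V) :
    IdealQuotient k (S i) ⥤ Gr X.toFunctor :=
  Gr.incl X.toFunctor ⟨i⟩

instance (i : V) : (grIncl X i).Additive :=
  Gr.incl_additive (X := X.toFunctor) ⟨i⟩

instance (i : V) : (grIncl X i).Linear k :=
  Gr.incl_linear (X := X.toFunctor) ⟨i⟩

lemma pathToGr_copyArrow {i : V} {x y : W i} (α : x ⟶ y) :
    (pathToGr X).map (copyArrow X α) =
      (grIncl X i).map ((proj k (S i)).map (ofArrow k α)) :=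
  (linearExtension_embedding _ _).trans (Category.id_comp _)

lemma pathToGr_pushArrow {i j : V} (a : i ⟶ j) (x : W i) :
    (pathToGr X).map (pushArrow X a x) =
      Gr.pushHom (X := X.toFunctor) (cls R a.toPath) ⟨vtx k x⟩ :=
  (linearExtension_embedding _ _).trans (Category.id_comp _)

lemma push_cls_eq {i j : V} (p : Quiver.Path i j) (x : W i) :
    Gr.push X.toFunctor (cls R p) ⟨vtx k x⟩ = ⟨vtx k (pathAct X p x)⟩ :=
  congrArg (fun y : W j => (⟨vtx k y⟩ : IdealQuotient k (S j))) (pathAct_eq X p x).symm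

lemma pathToGr_pathArrow {i j : V} (p : Quiver.Path i j) (x : W i) :
    (pathToGr X).map (pathArrow X p x) =
      Gr.ofDeg (X := X.toFunctor) (cls R p) (eqToHom (push_cls_eq p x)) := by
  induction p with
  | nil => exact (pathToGr X).map_id _
  | cons p a ih =>
    refine (congrArg (pathToGr X).map (pathArrow_cons p a x)).trans
      (((pathToGr X).map_comp _ _).trans
        ((congrArg₂ (· ≫ ·) ih (pathToGr_pushArrow a (pathAct X p x))).trans ?_))
    exact Gr.ofDeg_eqToHom_comp_pushHom (X := X.toFunctor) (cls R p) (cls R a.toPath)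
      (push_cls_eq p x)

lemma pathToGr_copyMap {i : V} {x y : PathCat k (W i)} (f : x ⟶ y) :
    (pathToGr X).map ((copyFunctor X i).map f) =
      (grIncl X i).map ((proj k (S i)).map f) := by
  let Φ : PathCat k (W i) ⥤ Gr X.toFunctor := copyFunctor X i ⋙ pathToGr X
  let Ψ : PathCat k (W i) ⥤ Gr X.toFunctor := proj k (S i) ⋙ grIncl X i
  have h := free_naturality_of_arrows Φ Ψ (fun x => 𝟙 (grObj X i x)) (fun {x y} α => ?_) f
  · exact (Category.comp_id (Φ.map f)).symm.trans (h.trans (Category.id_comp (Ψ.map f)))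
  · refine (Category.comp_id (Φ.map _)).trans (Eq.trans ?_ (Category.id_comp (Ψ.map _)).symm)
    exact (congrArg (pathToGr X).map (copyMap_ofArrow α)).trans (pathToGr_copyArrow α)

/-- The functor `pathToGr` respects the three types of relations. -/
lemma pathToGr_map_eq_zero {v w : PathCat k (GrVertex X)} (f : v ⟶ w) (hf : GrRel L f) :
    (pathToGr X).map f = 0 := by
  cases hf with
  | copied μ hμ =>
    have h := (proj_map_eq_iff (k := k) (S _) μ 0).2 (by rw [sub_zero]; exact subset_ideal hμ)
    refine (pathToGr_copyMap μ).trans ((congrArg (grIncl X _).map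
      (h.trans (Functor.map_zero _ _ _))).trans (Functor.map_zero _ _ _))
  | @lifted i j g h r x =>
    refine (pathToGr X).map_sub.trans (sub_eq_zero.2 ?_)
    refine (pathToGr_pathArrow g x).trans (Eq.trans ?_ ((pathToGr X).map_comp _ _).symm)
    have e : cls R g = cls R h := CategoryTheory.Quotient.sound R r
    have eqToHom_eq : ∀ {y z : W j} (hyz : y = z),
        (pathToGr X).map (eqToHom (congrArg (gv X j) hyz)) =
          (grIncl X j).map
            (eqToHom (congrArg (fun y : W j => (⟨vtx k y⟩ : IdealQuotient k (S j))) hyz)) := by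
      rintro y _ rfl
      exact ((pathToGr X).map_id _).trans ((grIncl X j).map_id _).symm
    refine Eq.trans ?_ (congrArg₂ (· ≫ ·) (pathToGr_pathArrow h x).symm
      (eqToHom_eq (pathAct_eq_of_rel X r x).symm).symm)
    refine Eq.trans ?_ (Gr.ofDeg_comp_incl (X := X.toFunctor) _ _ _).symm
    refine (Gr.ofDeg_congr (X := X.toFunctor) e.symm _).trans ?_
    exact congrArg (Gr.ofDeg (X := X.toFunctor) (cls R h))
      ((eqToHom_trans _ _).trans (eqToHom_trans _ _).symm)
  | @comm i j a x y α =>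
    refine (pathToGr X).map_sub.trans (sub_eq_zero.2 ?_)
    refine ((pathToGr X).map_comp _ _).trans (Eq.trans ?_ ((pathToGr X).map_comp _ _).symm)
    refine (congrArg₂ (· ≫ ·) (pathToGr_copyArrow α) (pathToGr_pushArrow a y)).trans
      (Eq.trans ?_ (congrArg₂ (· ≫ ·) (pathToGr_pushArrow a x).symm
        (pathToGr_copyMap (L.lift a α)).symm))
    refine (Gr.incl_comp_pushHom (X := X.toFunctor) (cls R a.toPath) _).trans ?_
    exact congrArg (fun f => Gr.pushHom (X := X.toFunctor) (cls R a.toPath) ⟨vtx k x⟩ ≫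
      (grIncl X j).map f) (L.proj_lift a α).symm

/-- The functor `kQ'/⟨R'⟩ ⥤ Gr(X)` given by `ᵢα ↦ α` and `(a, ᵢx) ↦ 𝟙 (ax)`. -/
def toGr : IdealQuotient k (GrRel L) ⥤ Gr X.toFunctor :=
  idealLift (pathToGr X) (pathToGr_map_eq_zero L)

instance : (toGr L).Additive := idealLift_additive _ (pathToGr_map_eq_zero L)

instance : (toGr L).Linear k := idealLift_linear _ (pathToGr_map_eq_zero L)

lemma toGr_map_qIncl {i : V} {x y : IdealQuotient k (S i)} (f : x ⟶ y) :
    (toGr L).map ((qIncl L i).map f) = (grIncl X i).map f := by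
  obtain ⟨f, rfl⟩ := proj_map_surjective f
  exact pathToGr_copyMap f

lemma toGr_map_qPath_snd {i j : V} (c : (⟨i⟩ : CategoryTheory.Quotient R) ⟶ ⟨j⟩) (x : W i) :
    (toGr L).map (qPath L c x).2 =
      Gr.ofDeg (X := X.toFunctor) c (eqToHom (push_eq_qPath_fst L c x).symm) := by
  -- The vertex `(qPath L c x).1` is generalized so that `qPath_cls` can be substituted.
  suffices H : ∀ m (hm : qPath L c x = m), (toGr L).map m.2 =
      Gr.ofDeg (X := X.toFunctor) c (eqToHom ((push_eq_qPath_fst L c x).symm.trans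
        (congrArg (fun m : Σ y : W j, (qObj L i x ⟶ qObj L j y) =>
          (⟨vtx k m.1⟩ : IdealQuotient k (S j))) hm))) from H _ rfl
  obtain ⟨p, rfl⟩ := cls_surjective c
  intro m hm
  obtain rfl := (qPath_cls L p x).symm.trans hm
  exact pathToGr_pathArrow p x

lemma toGr_map_ofGr (i : V) (x : W i) (j : V) (y : W j) (f : grObj X i x ⟶ grObj X j y) :
    (toGr L).map (ofGr L i x j y f) = f := by
  refine Gr.hom_induction (X := X.toFunctor)
    (P := fun f => (toGr L).map (ofGr L i x j y f) = f) ?_ (fun f g hf hg => ?_) (fun c f => ?_) f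
  · exact (congrArg (toGr L).map (map_zero (ofGr L i x j y))).trans (Functor.map_zero _ _ _)
  · exact (congrArg (toGr L).map (map_add (ofGr L i x j y) f g)).trans
      ((toGr L).map_add.trans (congrArg₂ (· + ·) hf hg))
  · refine (congrArg (toGr L).map (ofGr_ofDeg L c x y f)).trans
      (((toGr L).map_comp _ _).trans ((congrArg₂ (· ≫ ·) (toGr_map_qPath_snd L c x)
        (toGr_map_qIncl L _)).trans ((Gr.ofDeg_comp_incl (X := X.toFunctor) _ _ _).trans ?_)))
    rw [eqToHom_trans_assoc, eqToHom_refl, Category.id_comp]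

lemma ofGr_toGr_map (i : V) (x : W i) (j : V) (y : W j) (f : qObj L i x ⟶ qObj L j y) :
    ofGr L i x j y ((toGr L).map f) = f := by
  obtain ⟨g, rfl⟩ := ofGr_surjective L i x j y f
  exact congrArg (ofGr L i x j y) (toGr_map_ofGr L i x j y g)

/-! ### The isomorphism -/

/-- The inverse of `toGr`, which is `ofGr` on morphisms. It respects composition because `toGr` does
and `ofGr` is its inverse. -/
def fromGr : Gr X.toFunctor ⥤ IdealQuotient k (GrRel L) where
  obj p := qObj L p.base.as p.fiber.as
  map {p q} f := ofGr L p.base.as p.fiber.as q.base.as q.fiber.as f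
  map_id p := (congrArg (ofGr L _ _ _ _) ((toGr L).map_id
    (qObj L p.base.as p.fiber.as)).symm).trans (ofGr_toGr_map L _ _ _ _ _)
  map_comp {p q r} f g := by
    refine Eq.trans ?_ (ofGr_toGr_map L _ _ _ _ _)
    have h := (toGr L).map_comp (ofGr L p.base.as p.fiber.as q.base.as q.fiber.as f)
      (ofGr L q.base.as q.fiber.as r.base.as r.fiber.as g)
    exact congrArg (ofGr L _ _ _ _) (h.trans
      (congrArg₂ (· ≫ ·) (toGr_map_ofGr L _ _ _ _ f) (toGr_map_ofGr L _ _ _ _ g))).symm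

instance : (fromGr L).Additive where
  map_add {p q f g} := map_add (ofGr L p.base.as p.fiber.as q.base.as q.fiber.as) f g

instance : (fromGr L).Linear k where
  map_smul {p q} f r := map_smul (ofGr L p.base.as p.fiber.as q.base.as q.fiber.as) r f

/-- The isomorphism between `Gr(X)` and `kQ'/⟨R'⟩`. -/
def grIso : KCat.of k (Gr X.toFunctor) ≅ KCat.of k (IdealQuotient k (GrRel L)) where
  hom := { functor := fromGr L }
  inv := { functor := toGr L }
  hom_inv_id := KFunctor.ext (Functor.hext (fun _ => rfl) fun _ _ f =>
    heq_of_eq (toGr_map_ofGr L _ _ _ _ f))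
  inv_hom_id := KFunctor.ext (Functor.hext (fun _ => rfl) fun _ _ f =>
    heq_of_eq (ofGr_toGr_map L _ _ _ _ f))

end Main

end QuiverPresentation

end

theorem theorem3p1 {k : Type w} [Field k]
    {V : Type u₁} [Quiver.{v₁} V] (R : HomRel (Paths V))
    {W : V → Type u₂} [∀ i, Quiver.{v₂} (W i)] (S : ∀ i, MorphismProperty (PathCat k (W i)))
    (X : FunctorWithValues (presented R S)) :
    Nonempty (ArrowLift X) ∧
    (∀ L : ArrowLift X, Nonempty
      (KCat.of k (Gr X.toFunctor) ≅ KCat.of k (IdealQuotient k (GrRel L)))) ∧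
    (∀ (L L' : ArrowLift X) (x y : PathCat k (GrVertex X)),
      ideal k (GrRel L) x y = ideal k (GrRel L') x y) :=
  ⟨nonempty_arrowLift X, fun L => ⟨grIso L⟩, fun L L' x y =>
    (ideal_grRel_le L L' x y).antisymm (ideal_grRel_le L' L x y)⟩
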